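/- Let $S_\infty$ be the group of all permutations of $\omega$ with the topology of pointwise convergence, let $G$ be a closed subgroup of $S_\infty$, and let $X$ be a Polish $G$-space (a Polish space with a continuous action of the Polish group $G$) with a countable basis $\mathcal A$. Let $S^G_{<\infty}$ be the set of all restrictions $f|_d$ with $f\in G$ and $d\subset\omega$ finite. For $\sigma\in S^G_{<\infty}$ let $V^G_\sigma=\{f\in G: f\supseteq\sigma\}$, and for finite $c\subset\omega$ let $V^G_c=\{f\in G: f(k)=k \text{ for all } k\in c\}$. For $x\in X$ and $\sigma\in S^G_{<\infty}$ with $\mathrm{dom}[\sigma]=d$, $\mathrm{rng}[\sigma]=c$, define the $\alpha$-sets by recursion on the ordinal $\alpha>0$: $$B_1(x,\sigma)=\bigcap\{V^G_cA: A\in\mathcal A,\ V^G_\sigma x\cap A\neq\emptyset\}\cap\bigcap\{X\setminus V^G_cA: A\in\mathcal A,\ V^G_\sigma x\cap A=\emptyset\},$$ $$B_{\alpha+1}(x,\sigma)=\bigcap_{b\supseteq d}\bigcup\{B_\alpha(x,\sigma'):\sigma'\in S^G_{<\infty},\ \sigma'\supseteq\sigma,\ \mathrm{dom}[\sigma']=b\}\cap\bigcap_{a\supseteq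 c}\bigcup\{B_\alpha(x,\sigma'):\sigma'\in S^G_{<\infty},\ \sigma'\supseteq\sigma,\ \mathrm{rng}[\sigma']=a\}$$ (where $a,b$ range over finite subsets of $\omega$), and $B_\lambda(x,\sigma)=\bigcap_{0<\alpha<\lambda}B_\alpha(x,\sigma)$ for $\lambda$ limit. Put $\mathcal B^x_0=\mathcal A$, $\mathcal B^x_\beta=\{B_\beta(x,\sigma):\sigma\in S^G_{<\infty}\}$ for $\beta>0$, and $\mathcal B^x_{<\alpha}=\bigcup_{\gamma<\alpha}\mathcal B^x_\gamma$. Then for every $x\in X$ and every ordinal $0<\alpha<\omega_1$, the traces on $B_\alpha(x,\emptyset)$ of the members of $\mathcal B^x_{<\alpha}$ form a basis of a topology on $B_\alpha(x,\emptyset)$, the set $B_\alpha(x,\emptyset)$ is $G$-invariant, and with this topology and the restricted action of $G$ it is a Polish $G$-space. -/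

import Mathlib

open scoped Pointwise

namespace ScottAnalysis

/-- The topology of pointwise convergence on the group `S_∞` of all permutations of `ℕ`. -/
instance permTopology : TopologicalSpace (Equiv.Perm ℕ) :=
  TopologicalSpace.induced (fun f : Equiv.Perm ℕ => (f : ℕ → ℕ)) inferInstance

/-- `X` is a Polish `G`-space: `G` is a Polish group, `X` is a Polish space and the action of
`G` on `X` is (jointly) continuous. -/
structure IsPolishGSpace (G X : Type*) [Group G] [TopologicalSpace G] [TopologicalSpace X]
    [MulAction G X] : Prop where
  isTopologicalGroup : IsTopologicalGroup G
  polishSpace_group : PolishSpace G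
  polishSpace : PolishSpace X
  continuousSMul : ContinuousSMul G X

/-- The restriction of a permutation `f` of `ℕ` to a finite set `d`.
Finite partial maps are represented by their graphs, so that `σ ⊆ σ'` says that `σ'` extends `σ`
and `∅` is the empty map. -/
def restrict (f : Equiv.Perm ℕ) (d : Finset ℕ) : Finset (ℕ × ℕ) :=
  d.image fun k => (k, f k)

/-- The domain of a finite partial map. -/
def dom (σ : Finset (ℕ × ℕ)) : Finset ℕ := σ.image Prod.fst

/-- The range of a finite partial map. -/
def rng (σ : Finset (ℕ × ℕ)) : Finset ℕ := σ.image Prod.snd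

/-- `S_{<∞}^G`: the restrictions of the elements of `G` to the finite sets of natural numbers. -/
def finPartial (G : Subgroup (Equiv.Perm ℕ)) : Set (Finset (ℕ × ℕ)) :=
  {σ | ∃ f ∈ G, ∃ d : Finset ℕ, σ = restrict f d}

/-- `V_σ^G`: the elements of `G` that extend the finite partial map `σ`. -/
def extending (G : Subgroup (Equiv.Perm ℕ)) (σ : Finset (ℕ × ℕ)) : Set G :=
  {g | ∀ p ∈ σ, (g : Equiv.Perm ℕ) p.1 = p.2}

/-- `V_c^G`: the elements of `G` that fix every point of `c`. -/
def fixing (G : Subgroup (Equiv.Perm ℕ)) (c : Finset ℕ) : Set G :=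
  {g | ∀ k ∈ c, (g : Equiv.Perm ℕ) k = k}

section Sets

variable (G : Subgroup (Equiv.Perm ℕ)) {X : Type*} [MulAction G X]

/-- The part `V_σ^G x` of the orbit of `x`. -/
def partialOrbit (x : X) (σ : Finset (ℕ × ℕ)) : Set X := (fun g : G => g • x) '' extending G σ

/-- The set `B_1(x, σ)`; here `fixing G c • A` is `V_c^G A = {g • a | g ∈ V_c^G, a ∈ A}`. -/
def oneSet (𝓐 : Set (Set X)) (x : X) (σ : Finset (ℕ × ℕ)) : Set X :=
  (⋂ A ∈ {A ∈ 𝓐 | (partialOrbit G x σ ∩ A).Nonempty}, fixing G (rng σ) • A) ∩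
    ⋂ A ∈ {A ∈ 𝓐 | partialOrbit G x σ ∩ A = ∅}, (fixing G (rng σ) • A)ᶜ

/-- The passage from the family `σ ↦ B_α(x, σ)` to the set `B_{α+1}(x, σ)`. -/
def succStep (B : Finset (ℕ × ℕ) → Set X) (σ : Finset (ℕ × ℕ)) : Set X :=
  (⋂ b ∈ {b : Finset ℕ | dom σ ⊆ b},
      ⋃ σ' ∈ {σ' ∈ finPartial G | σ ⊆ σ' ∧ dom σ' = b}, B σ') ∩
    ⋂ a ∈ {a : Finset ℕ | rng σ ⊆ a},
      ⋃ σ' ∈ {σ' ∈ finPartial G | σ ⊆ σ' ∧ rng σ' = a}, B σ'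

open Classical in
/-- The `α`-sets `B_α(x, σ)`, by recursion on the ordinal `α`. They are meaningful for `0 < α`
only; the whole space is a dummy value at `α = 0`. -/
noncomputable def alphaSet (𝓐 : Set (Set X)) (x : X) (α : Ordinal.{0}) :
    Finset (ℕ × ℕ) → Set X :=
  Ordinal.limitRecOn (motive := fun _ => Finset (ℕ × ℕ) → Set X) α
    (fun _ => Set.univ)
    (fun β B => if β = 0 then oneSet G 𝓐 x else succStep G B)
    (fun lam _ B σ => ⋂ (β : Ordinal.{0}) (h : β < lam) (_ : 0 < β), B β h σ)

theorem alphaSet_one (𝓐 : Set (Set X)) (x : X) : alphaSet G 𝓐 x 1 = oneSet G 𝓐 x := by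
  have h := Ordinal.limitRecOn_add_one (motive := fun _ => Finset (ℕ × ℕ) → Set X)
    (0 : Ordinal.{0}) (fun _ => Set.univ)
    (fun β B => if β = 0 then oneSet G 𝓐 x else succStep G B)
    (fun lam _ B σ => ⋂ (β : Ordinal.{0}) (h : β < lam) (_ : 0 < β), B β h σ)
  rw [if_pos rfl, zero_add] at h
  exact h

theorem alphaSet_add_one (𝓐 : Set (Set X)) (x : X) {α : Ordinal.{0}} (hα : 0 < α) :
    alphaSet G 𝓐 x (α + 1) = succStep G (alphaSet G 𝓐 x α) := by
  rw [alphaSet, Ordinal.limitRecOn_add_one, if_neg hα.ne']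
  rfl

theorem alphaSet_limit (𝓐 : Set (Set X)) (x : X) {lam : Ordinal.{0}}
    (hlam : Order.IsSuccLimit lam) (σ : Finset (ℕ × ℕ)) :
    alphaSet G 𝓐 x lam σ =
      ⋂ (β : Ordinal.{0}) (_ : β < lam) (_ : 0 < β), alphaSet G 𝓐 x β σ := by
  rw [alphaSet, Ordinal.limitRecOn_limit _ _ _ _ hlam]
  rfl

open Classical in
/-- The family `𝓑^x_β`: the given basis for `β = 0`, and `{B_β(x, σ) | σ ∈ S_{<∞}^G}` for
`0 < β`. -/
noncomputable def family (𝓐 : Set (Set X)) (x : X) (β : Ordinal.{0}) : Set (Set X) :=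
  if β = 0 then 𝓐 else alphaSet G 𝓐 x β '' finPartial G

/-- The family `𝓑^x_{<α} = ⋃_{γ < α} 𝓑^x_γ`. -/
noncomputable def familyBelow (𝓐 : Set (Set X)) (x : X) (α : Ordinal.{0}) : Set (Set X) :=
  ⋃ γ ∈ Set.Iio α, family G 𝓐 x γ

/-- The traces on `Y` of the members of a family `𝓕` of subsets of `X`. -/
def traces {X : Type*} (𝓕 : Set (Set X)) (Y : Set X) : Set (Set Y) :=
  (fun B => (Subtype.val ⁻¹' B : Set Y)) '' 𝓕

/-- The topology on `B_α(x, ∅)` generated by the traces of the members of `𝓑^x_{<α}`. -/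
abbrev alphaTopology (𝓐 : Set (Set X)) (x : X) (α : Ordinal.{0}) :
    TopologicalSpace (alphaSet G 𝓐 x α ∅) :=
  TopologicalSpace.generateFrom (traces (familyBelow G 𝓐 x α) (alphaSet G 𝓐 x α ∅))

end Sets

/-- The action of a group on an invariant subset, by restriction. -/
abbrev restrictedAction {G X : Type*} [Group G] [MulAction G X] (Y : Set X)
    (hY : ∀ g : G, ∀ y ∈ Y, g • y ∈ Y) : MulAction G Y where
  smul g y := ⟨g • (y : X), hY g y y.2⟩
  one_smul y := Subtype.ext (one_smul G (y : X))
  mul_smul g h y := Subtype.ext (mul_smul g h (y : X))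

end ScottAnalysis

/-!
The heart of the matter is a back-and-forth argument. The α-sets are decreasing in `α` and in `σ`,
and `g • B_α(x, σ) = B_α(x, g ∘ σ)` for `g` in `G`, so that `B_α(x, σ)` is invariant under `V_c`,
where `c` is the range of `σ`. For a fixed finite set `c`, the α-sets `B_α(x, σ)` with
`rng σ = c` are pairwise equal or disjoint (`alphaSet_subset_of_mem`).

*Basis.* Let `1 < α`. By regularity of `X`, each `A` in `𝓐` is a union of 1-sets on `B_α(x, ∅)`
(`exists_oneSet_subset`). If `y` lies in `B_γ(x, σ)` and `B_δ(x, τ)` with `γ ≤ δ < α`, then the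
definition of `B_{δ+1}(x, ∅)` gives `ρ` with range `rng σ ∪ rng τ` and `y` in `B_δ(x, ρ)`; by
monotonicity and disjointness this set is contained in both.

*Polishness* (`polishOn_alphaSet`). This goes by induction on `α`, with `T_α` the topology on `X`
generated by `𝓑^x_{<α}`. Each `B_α(x, σ)` is a `Gδ` set for `T_α`, hence Polish as a subset of the
Polish space `B_α(x, ∅)`. For a fixed finite set `a`, the α-sets with range `a` are disjoint, so
making them open turns their union `Z_a` into a countable sum of Polish spaces. Then `⋂ a, Z_a`
with the join of these topologies, which is `T_{α+1}`, is a closed subspace of a countable product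
of Polish spaces, and `B_{α+1}(x, ∅)` is a `Gδ` subset of it. At limits only the last intersection
argument is needed.

*Continuity of the action.* The inverse image of `B_γ(x, σ)` near `(g, y)` contains
`V_c g × B_γ(x, g⁻¹ ∘ σ)`, where `c` is the range of `σ`.
-/

namespace ScottAnalysis

open scoped Topology

/-! ### Finite partial maps -/

section FinitePartialMaps

/-- The finite partial map `g ∘ σ`. -/
def postcomp (g : Equiv.Perm ℕ) (σ : Finset (ℕ × ℕ)) : Finset (ℕ × ℕ) :=
  σ.image fun p => (p.1, g p.2)

theorem mem_restrict {f : Equiv.Perm ℕ} {d : Finset ℕ} {p : ℕ × ℕ} :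
    p ∈ restrict f d ↔ p.1 ∈ d ∧ f p.1 = p.2 := by
  obtain ⟨a, b⟩ := p
  simp only [restrict, Finset.mem_image, Prod.mk.injEq]
  constructor
  · rintro ⟨k, hk, rfl, rfl⟩
    exact ⟨hk, rfl⟩
  · rintro ⟨h, h'⟩
    exact ⟨a, h, rfl, h'⟩

@[simp] theorem dom_restrict (f : Equiv.Perm ℕ) (d : Finset ℕ) : dom (restrict f d) = d := by
  simp [dom, restrict, Finset.image_image, Function.comp_def]

@[simp] theorem rng_restrict (f : Equiv.Perm ℕ) (d : Finset ℕ) :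
    rng (restrict f d) = d.image f := by
  simp [rng, restrict, Finset.image_image, Function.comp_def]

theorem dom_mono {σ τ : Finset (ℕ × ℕ)} (h : σ ⊆ τ) : dom σ ⊆ dom τ :=
  Finset.image_subset_image h

theorem rng_mono {σ τ : Finset (ℕ × ℕ)} (h : σ ⊆ τ) : rng σ ⊆ rng τ :=
  Finset.image_subset_image h

@[simp] theorem dom_postcomp (g : Equiv.Perm ℕ) (σ : Finset (ℕ × ℕ)) :
    dom (postcomp g σ) = dom σ := by
  simp [dom, postcomp, Finset.image_image, Function.comp_def]

theorem rng_postcomp (g : Equiv.Perm ℕ) (σ : Finset (ℕ × ℕ)) :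
    rng (postcomp g σ) = (rng σ).image g := by
  simp [rng, postcomp, Finset.image_image, Function.comp_def]

theorem postcomp_mono (g : Equiv.Perm ℕ) {σ τ : Finset (ℕ × ℕ)} (h : σ ⊆ τ) :
    postcomp g σ ⊆ postcomp g τ :=
  Finset.image_subset_image h

theorem postcomp_restrict (g f : Equiv.Perm ℕ) (d : Finset ℕ) :
    postcomp g (restrict f d) = restrict (g * f) d := by
  simp [postcomp, restrict, Finset.image_image, Function.comp_def]

theorem postcomp_postcomp (g h : Equiv.Perm ℕ) (σ : Finset (ℕ × ℕ)) :
    postcomp g (postcomp h σ) = postcomp (g * h) σ := by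
  simp [postcomp, Finset.image_image, Function.comp_def]

theorem postcomp_eq_self {g : Equiv.Perm ℕ} {σ : Finset (ℕ × ℕ)} (h : ∀ k ∈ rng σ, g k = k) :
    postcomp g σ = σ := by
  have : Set.EqOn (fun p : ℕ × ℕ => (p.1, g p.2)) id σ := fun p hp =>
    Prod.ext rfl (h p.2 (Finset.mem_image_of_mem _ hp))
  rw [postcomp, Finset.image_congr this, Finset.image_id]

variable {G : Subgroup (Equiv.Perm ℕ)}

theorem restrict_mem {f : Equiv.Perm ℕ} (hf : f ∈ G) (d : Finset ℕ) :
    restrict f d ∈ finPartial G :=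
  ⟨f, hf, d, rfl⟩

theorem empty_mem_finPartial : (∅ : Finset (ℕ × ℕ)) ∈ finPartial G :=
  restrict_mem G.one_mem ∅

theorem postcomp_mem (g : G) {σ : Finset (ℕ × ℕ)} (hσ : σ ∈ finPartial G) :
    postcomp (g : Equiv.Perm ℕ) σ ∈ finPartial G := by
  obtain ⟨f, hf, d, rfl⟩ := hσ
  rw [postcomp_restrict]
  exact restrict_mem (G.mul_mem g.2 hf) d

theorem postcomp_inv_postcomp (g : G) (σ : Finset (ℕ × ℕ)) :
    postcomp (g : Equiv.Perm ℕ) (postcomp ((g⁻¹ : G) : Equiv.Perm ℕ) σ) = σ := by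
  rw [postcomp_postcomp]
  exact postcomp_eq_self fun k _ => by simp

theorem exists_restrict_dom {σ τ : Finset (ℕ × ℕ)} (hτ : τ ∈ finPartial G) (h : σ ⊆ τ)
    {b : Finset ℕ} (hb : dom σ ⊆ b) (hb' : b ⊆ dom τ) :
    ∃ ρ ∈ finPartial G, σ ⊆ ρ ∧ ρ ⊆ τ ∧ dom ρ = b := by
  obtain ⟨f, hf, d, rfl⟩ := hτ
  rw [dom_restrict] at hb'
  refine ⟨restrict f b, restrict_mem hf b, fun p hp => ?_, fun p hp => ?_, dom_restrict f b⟩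
  · exact mem_restrict.2 ⟨hb (Finset.mem_image_of_mem _ hp), (mem_restrict.1 (h hp)).2⟩
  · rw [mem_restrict] at hp ⊢
    exact ⟨hb' hp.1, hp.2⟩

theorem exists_restrict_rng {σ τ : Finset (ℕ × ℕ)} (hτ : τ ∈ finPartial G) (h : σ ⊆ τ)
    {a : Finset ℕ} (ha : rng σ ⊆ a) (ha' : a ⊆ rng τ) :
    ∃ ρ ∈ finPartial G, σ ⊆ ρ ∧ ρ ⊆ τ ∧ rng ρ = a := by
  obtain ⟨f, hf, d, rfl⟩ := hτ
  rw [rng_restrict] at ha'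
  refine ⟨restrict f (a.image f.symm), restrict_mem hf _, fun p hp => ?_, fun p hp => ?_, ?_⟩
  · have hp' := (mem_restrict.1 (h hp)).2
    refine mem_restrict.2 ⟨Finset.mem_image.2 ⟨p.2, ha (Finset.mem_image_of_mem _ hp), ?_⟩, hp'⟩
    rw [← hp', Equiv.symm_apply_apply]
  · rw [mem_restrict] at hp ⊢
    obtain ⟨m, hm, hm'⟩ := Finset.mem_image.1 hp.1
    obtain ⟨k, hk, rfl⟩ := Finset.mem_image.1 (ha' hm)
    rw [Equiv.symm_apply_apply] at hm'
    exact ⟨hm' ▸ hk, hp.2⟩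
  · simp [Finset.image_image, Function.comp_def]

/-- Two extensions of `σ` with the same domain differ by an element of `G` that fixes the range
of `σ` pointwise. -/
theorem exists_postcomp_eq {σ ρ τ : Finset (ℕ × ℕ)} (hρ : ρ ∈ finPartial G)
    (hτ : τ ∈ finPartial G) (h : dom ρ = dom τ) (hσρ : σ ⊆ ρ) (hστ : σ ⊆ τ) :
    ∃ g ∈ fixing G (rng σ), postcomp (g : Equiv.Perm ℕ) ρ = τ := by
  obtain ⟨f, hf, d, rfl⟩ := hρ
  obtain ⟨f', hf', d', rfl⟩ := hτ
  obtain rfl : d = d' := by simpa using h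
  refine ⟨⟨f' * f⁻¹, G.mul_mem hf' (G.inv_mem hf)⟩, fun k hk => ?_, ?_⟩
  · obtain ⟨p, hp, rfl⟩ := Finset.mem_image.1 hk
    have h₁ := (mem_restrict.1 (hσρ hp)).2
    have h₂ := (mem_restrict.1 (hστ hp)).2
    simp only [Equiv.Perm.mul_apply]
    rw [Equiv.Perm.inv_eq_iff_eq.2 h₁.symm, h₂]
  · rw [postcomp_restrict]
    simp

/-! ### Pointwise stabilizers and the sets `B_1(x, σ)` -/

theorem one_mem_fixing (c : Finset ℕ) : (1 : G) ∈ fixing G c := fun _ _ => rfl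

theorem mul_mem_fixing {c : Finset ℕ} {g h : G} (hg : g ∈ fixing G c) (hh : h ∈ fixing G c) :
    g * h ∈ fixing G c := fun k hk => by
  rw [Subgroup.coe_mul, Equiv.Perm.mul_apply, hh k hk, hg k hk]

theorem inv_mem_fixing {c : Finset ℕ} {g : G} (hg : g ∈ fixing G c) : g⁻¹ ∈ fixing G c :=
  fun k hk => by
    rw [Subgroup.coe_inv, Equiv.Perm.inv_eq_iff_eq, hg k hk]

theorem fixing_anti {c c' : Finset ℕ} (h : c ⊆ c') : fixing G c' ⊆ fixing G c :=
  fun _ hg k hk => hg k (h hk)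

theorem mul_mem_extending {σ : Finset (ℕ × ℕ)} {g f : G} (hg : g ∈ fixing G (rng σ))
    (hf : f ∈ extending G σ) : g * f ∈ extending G σ := fun p hp => by
  rw [Subgroup.coe_mul, Equiv.Perm.mul_apply, hf p hp, hg _ (Finset.mem_image_of_mem _ hp)]

theorem mul_inv_mem_fixing {σ : Finset (ℕ × ℕ)} {f f' : G} (hf : f ∈ extending G σ)
    (hf' : f' ∈ extending G σ) : f * f'⁻¹ ∈ fixing G (rng σ) := fun k hk => by
  obtain ⟨p, hp, rfl⟩ := Finset.mem_image.1 hk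
  rw [Subgroup.coe_mul, Equiv.Perm.mul_apply, Subgroup.coe_inv,
    Equiv.Perm.inv_eq_iff_eq.2 (hf' p hp).symm, hf p hp]

theorem extending_nonempty {σ : Finset (ℕ × ℕ)} (hσ : σ ∈ finPartial G) :
    (extending G σ).Nonempty := by
  obtain ⟨f, hf, d, rfl⟩ := hσ
  exact ⟨⟨f, hf⟩, fun p hp => (mem_restrict.1 hp).2⟩

theorem extending_anti {σ τ : Finset (ℕ × ℕ)} (h : σ ⊆ τ) : extending G τ ⊆ extending G σ :=
  fun _ hg p hp => hg p (h hp)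

theorem inv_mul_mem_extending {g f : G} {σ : Finset (ℕ × ℕ)} :
    g⁻¹ * f ∈ extending G σ ↔ f ∈ extending G (postcomp (g : Equiv.Perm ℕ) σ) := by
  constructor
  · intro h p hp
    obtain ⟨q, hq, rfl⟩ := Finset.mem_image.1 hp
    have := h q hq
    rw [Subgroup.coe_mul, Equiv.Perm.mul_apply, Subgroup.coe_inv,
      Equiv.Perm.inv_eq_iff_eq] at this
    exact this
  · intro h q hq
    rw [Subgroup.coe_mul, Equiv.Perm.mul_apply, Subgroup.coe_inv, Equiv.Perm.inv_eq_iff_eq]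
    exact h _ (Finset.mem_image_of_mem _ hq)

theorem conj_mem_fixing {g h : G} {c : Finset ℕ} :
    g⁻¹ * h * g ∈ fixing G c ↔ h ∈ fixing G (c.image (g : Equiv.Perm ℕ)) := by
  have : ∀ k, ((g⁻¹ * h * g : G) : Equiv.Perm ℕ) k = k ↔
      (h : Equiv.Perm ℕ) ((g : Equiv.Perm ℕ) k) = (g : Equiv.Perm ℕ) k := fun k => by
    rw [mul_assoc, Subgroup.coe_mul, Equiv.Perm.mul_apply, Subgroup.coe_inv,
      Equiv.Perm.inv_eq_iff_eq, Subgroup.coe_mul, Equiv.Perm.mul_apply]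
  constructor
  · intro H m hm
    obtain ⟨k, hk, rfl⟩ := Finset.mem_image.1 hm
    exact (this k).1 (H k hk)
  · intro H k hk
    exact (this k).2 (H _ (Finset.mem_image_of_mem _ hk))

section Action

variable {X : Type*} [MulAction G X] {𝓐 : Set (Set X)} {x y z : X}
  {σ τ : Finset (ℕ × ℕ)} {α β : Ordinal.{0}}

theorem mem_fixing_smul {c : Finset ℕ} {A : Set X} :
    y ∈ fixing G c • A ↔ ∃ g ∈ fixing G c, g • y ∈ A := by
  constructor
  · rintro ⟨g, hg, a, ha, rfl⟩
    exact ⟨g⁻¹, inv_mem_fixing hg, by simpa using ha⟩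
  · rintro ⟨g, hg, h⟩
    exact ⟨g⁻¹, inv_mem_fixing hg, g • y, h, by simp⟩

theorem partialOrbit_inter_nonempty {A : Set X} :
    (partialOrbit G x σ ∩ A).Nonempty ↔ ∃ f ∈ extending G σ, f • x ∈ A := by
  constructor
  · rintro ⟨_, ⟨f, hf, rfl⟩, h⟩
    exact ⟨f, hf, h⟩
  · rintro ⟨f, hf, h⟩
    exact ⟨_, ⟨f, hf, rfl⟩, h⟩

theorem mem_oneSet_iff : y ∈ oneSet G 𝓐 x σ ↔ ∀ A ∈ 𝓐,
    ((∃ g ∈ fixing G (rng σ), g • y ∈ A) ↔ ∃ f ∈ extending G σ, f • x ∈ A) := by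
  simp only [oneSet, Set.mem_inter_iff, Set.mem_iInter₂, Set.mem_ofPred_eq, and_imp,
    Set.mem_compl_iff, mem_fixing_smul, ← Set.not_nonempty_iff_eq_empty,
    partialOrbit_inter_nonempty]
  constructor
  · intro h A hA
    exact ⟨fun h' => by_contra fun h'' => h.2 A hA h'' h', h.1 A hA⟩
  · intro h
    exact ⟨fun A hA => (h A hA).2, fun A hA h' h'' => h' ((h A hA).1 h'')⟩

theorem oneSet_eq_of_mem (hc : rng σ = rng τ) (hσ : y ∈ oneSet G 𝓐 x σ)
    (hτ : y ∈ oneSet G 𝓐 x τ) : oneSet G 𝓐 x σ ⊆ oneSet G 𝓐 x τ := by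
  intro z hz
  rw [mem_oneSet_iff] at *
  intro A hA
  rw [← hc, hz A hA, ← hσ A hA, hc, hτ A hA]

variable [TopologicalSpace X]

/-- `B_1(x, σ)` consists of the points `y` for which `V_c y` and `V_σ x`, where `c` is the range
of `σ`, have the same closure. -/
theorem mem_oneSet_iff_isOpen (h𝓐 : TopologicalSpace.IsTopologicalBasis 𝓐) :
    y ∈ oneSet G 𝓐 x σ ↔ ∀ U : Set X, IsOpen U →
      ((∃ g ∈ fixing G (rng σ), g • y ∈ U) ↔ ∃ f ∈ extending G σ, f • x ∈ U) := by
  rw [mem_oneSet_iff]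
  refine ⟨fun h U hU => ⟨?_, ?_⟩, fun h A hA => h A (h𝓐.isOpen hA)⟩
  · rintro ⟨g, hg, hgU⟩
    obtain ⟨A, hA, hgA, hAU⟩ := h𝓐.exists_subset_of_mem_open hgU hU
    obtain ⟨f, hf, hfA⟩ := (h A hA).1 ⟨g, hg, hgA⟩
    exact ⟨f, hf, hAU hfA⟩
  · rintro ⟨f, hf, hfU⟩
    obtain ⟨A, hA, hfA, hAU⟩ := h𝓐.exists_subset_of_mem_open hfU hU
    obtain ⟨g, hg, hgA⟩ := (h A hA).2 ⟨f, hf, hfA⟩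
    exact ⟨g, hg, hAU hgA⟩

variable [ContinuousConstSMul G X]

theorem isOpen_fixing_smul (c : Finset ℕ) {A : Set X} (hA : IsOpen A) :
    IsOpen (fixing G c • A) := hA.smul_left

theorem oneSet_anti (h𝓐 : TopologicalSpace.IsTopologicalBasis 𝓐) (hτ : τ ∈ finPartial G)
    (h : σ ⊆ τ) : oneSet G 𝓐 x τ ⊆ oneSet G 𝓐 x σ := by
  intro y hy
  rw [mem_oneSet_iff_isOpen h𝓐] at *
  intro U hU
  -- The hypothesis on `τ` is applied to the open set `V_c U`, where `c` is the range of `σ`.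
  have key := hy _ (isOpen_fixing_smul (G := G) (rng σ) hU)
  simp only [mem_fixing_smul] at key
  constructor
  · rintro ⟨g, hg, hgU⟩
    obtain ⟨f, hf, g', hg', hU'⟩ :=
      key.1 ⟨1, one_mem_fixing _, g, hg, by simpa using hgU⟩
    exact ⟨g' * f, mul_mem_extending hg' (extending_anti h hf), by simpa [mul_smul] using hU'⟩
  · rintro ⟨f, hf, hfU⟩
    obtain ⟨f', hf'⟩ := extending_nonempty hτ
    obtain ⟨g, hg, g', hg', hU'⟩ := key.2 ⟨f', hf', f * f'⁻¹,
      mul_inv_mem_fixing hf (extending_anti h hf'), by simpa [mul_smul] using hfU⟩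
    exact ⟨g' * g, mul_mem_fixing hg' (fixing_anti (rng_mono h) hg),
      by simpa [mul_smul] using hU'⟩

theorem smul_mem_oneSet (h𝓐 : TopologicalSpace.IsTopologicalBasis 𝓐) (g : G)
    (hy : y ∈ oneSet G 𝓐 x σ) : g • y ∈ oneSet G 𝓐 x (postcomp (g : Equiv.Perm ℕ) σ) := by
  rw [mem_oneSet_iff_isOpen h𝓐] at *
  intro U hU
  have key := hy (g⁻¹ • U) (hU.smul g⁻¹)
  simp only [Set.mem_inv_smul_set_iff] at key
  rw [rng_postcomp]
  constructor
  · rintro ⟨h, hh, hU'⟩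
    obtain ⟨f, hf, hfU⟩ := key.1 ⟨g⁻¹ * h * g, conj_mem_fixing.2 hh, by
      simpa [mul_smul] using hU'⟩
    exact ⟨g * f, inv_mul_mem_extending.1 (by simpa using hf), by simpa [mul_smul] using hfU⟩
  · rintro ⟨f, hf, hfU⟩
    obtain ⟨h, hh, hU'⟩ := key.2 ⟨g⁻¹ * f, inv_mul_mem_extending.2 hf, by
      simpa [mul_smul] using hfU⟩
    exact ⟨g * h * g⁻¹, conj_mem_fixing.1 (by simpa [mul_assoc] using hh),
      by simpa [mul_smul] using hU'⟩

end Action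

end FinitePartialMaps

/-! ### The α-sets -/

theorem mem_succStep_iff {G : Subgroup (Equiv.Perm ℕ)} {X : Type*} {B : Finset (ℕ × ℕ) → Set X}
    {σ : Finset (ℕ × ℕ)} {y : X} : y ∈ succStep G B σ ↔
    (∀ b, dom σ ⊆ b → ∃ ρ ∈ finPartial G, σ ⊆ ρ ∧ dom ρ = b ∧ y ∈ B ρ) ∧
    ∀ a, rng σ ⊆ a → ∃ ρ ∈ finPartial G, σ ⊆ ρ ∧ rng ρ = a ∧ y ∈ B ρ := by
  simp only [succStep, Set.mem_inter_iff, Set.mem_iInter₂, Set.mem_ofPred_eq, Set.mem_iUnion₂,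
    exists_prop, and_assoc]

section AlphaSet

variable {G : Subgroup (Equiv.Perm ℕ)} {X : Type*} [MulAction G X] {𝓐 : Set (Set X)} {x y z : X}
  {σ τ : Finset (ℕ × ℕ)} {α β : Ordinal.{0}}

/-- Induction on positive ordinals, following the recursion that defines the α-sets. -/
theorem ordinal_pos_induction {P : ∀ α : Ordinal.{0}, 0 < α → Prop} (one : P 1 one_pos)
    (succ : ∀ α (hα : 0 < α), P α hα → P (α + 1) (Order.lt_add_one_iff.2 hα.le))
    (limit : ∀ lam (hlam : Order.IsSuccLimit lam),
      (∀ β < lam, ∀ hβ : 0 < β, P β hβ) → P lam hlam.bot_lt)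
    (α : Ordinal.{0}) (hα : 0 < α) : P α hα := by
  induction α using Ordinal.limitRecOn with
  | zero => exact absurd hα (lt_irrefl _)
  | add_one β ih =>
    rcases eq_or_ne β 0 with rfl | hβ
    · simpa using one
    · exact succ β (pos_iff_ne_zero.2 hβ) (ih (pos_iff_ne_zero.2 hβ))
  | limit lam hlam ih => exact limit lam hlam fun β hβ hβ₀ => ih β hβ hβ₀

theorem mem_alphaSet_limit {lam : Ordinal.{0}} (hlam : Order.IsSuccLimit lam) :
    y ∈ alphaSet G 𝓐 x lam σ ↔ ∀ β < lam, 0 < β → y ∈ alphaSet G 𝓐 x β σ := by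
  simp [alphaSet_limit G 𝓐 x hlam]

variable [TopologicalSpace X] [ContinuousConstSMul G X]

theorem alphaSet_anti (h𝓐 : TopologicalSpace.IsTopologicalBasis 𝓐) (hα : 0 < α)
    (hτ : τ ∈ finPartial G) (h : σ ⊆ τ) : alphaSet G 𝓐 x α τ ⊆ alphaSet G 𝓐 x α σ := by
  induction α, hα using ordinal_pos_induction generalizing σ τ with
  | one => rw [alphaSet_one]; exact oneSet_anti h𝓐 hτ h
  | succ α hα ih =>
    rw [alphaSet_add_one G 𝓐 x hα]
    intro y hy
    rw [mem_succStep_iff] at hy ⊢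
    refine ⟨fun b hb => ?_, fun a ha => ?_⟩
    · obtain ⟨ρ, hρ, hτρ, hd, hyρ⟩ := hy.1 (b ∪ dom τ) Finset.subset_union_right
      obtain ⟨π, hπ, hσπ, hπρ, hπb⟩ := exists_restrict_dom hρ (h.trans hτρ) hb
        (hd ▸ Finset.subset_union_left)
      exact ⟨π, hπ, hσπ, hπb, ih hρ hπρ hyρ⟩
    · obtain ⟨ρ, hρ, hτρ, hd, hyρ⟩ := hy.2 (a ∪ rng τ) Finset.subset_union_right
      obtain ⟨π, hπ, hσπ, hπρ, hπa⟩ := exists_restrict_rng hρ (h.trans hτρ) ha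
        (hd ▸ Finset.subset_union_left)
      exact ⟨π, hπ, hσπ, hπa, ih hρ hπρ hyρ⟩
  | limit lam hlam ih =>
    intro y hy
    rw [mem_alphaSet_limit hlam] at hy ⊢
    exact fun β hβ hβ₀ => ih β hβ hβ₀ hτ h (hy β hβ hβ₀)

theorem alphaSet_subset_empty (h𝓐 : TopologicalSpace.IsTopologicalBasis 𝓐) (hα : 0 < α)
    (hσ : σ ∈ finPartial G) : alphaSet G 𝓐 x α σ ⊆ alphaSet G 𝓐 x α ∅ :=
  alphaSet_anti h𝓐 hα hσ (Finset.empty_subset σ)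

theorem alphaSet_antitone (h𝓐 : TopologicalSpace.IsTopologicalBasis 𝓐) (hα : 0 < α)
    (h : α ≤ β) (σ : Finset (ℕ × ℕ)) : alphaSet G 𝓐 x β σ ⊆ alphaSet G 𝓐 x α σ := by
  have hβ : 0 < β := hα.trans_le h
  induction β, hβ using ordinal_pos_induction with
  | one => rw [le_antisymm h (Order.one_le_iff_pos.2 hα)]
  | succ β hβ ih =>
    rcases h.eq_or_lt with rfl | h
    · exact subset_rfl
    refine subset_trans ?_ (ih (Order.lt_add_one_iff.1 h))
    rw [alphaSet_add_one G 𝓐 x hβ]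
    intro y hy
    obtain ⟨ρ, hρ, hσρ, -, hyρ⟩ := (mem_succStep_iff.1 hy).1 _ subset_rfl
    exact alphaSet_anti h𝓐 hβ hρ hσρ hyρ
  | limit lam hlam ih =>
    rcases h.eq_or_lt with rfl | h
    · exact subset_rfl
    exact fun y hy => (mem_alphaSet_limit hlam).1 hy α h hα

theorem smul_mem_alphaSet (h𝓐 : TopologicalSpace.IsTopologicalBasis 𝓐) (hα : 0 < α) (g : G)
    (hy : y ∈ alphaSet G 𝓐 x α σ) :
    g • y ∈ alphaSet G 𝓐 x α (postcomp (g : Equiv.Perm ℕ) σ) := by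
  induction α, hα using ordinal_pos_induction generalizing σ with
  | one => rw [alphaSet_one] at *; exact smul_mem_oneSet h𝓐 g hy
  | succ α hα ih =>
    rw [alphaSet_add_one G 𝓐 x hα, mem_succStep_iff] at *
    refine ⟨fun b hb => ?_, fun a ha => ?_⟩
    · rw [dom_postcomp] at hb
      obtain ⟨ρ, hρ, hσρ, hd, hyρ⟩ := hy.1 b hb
      exact ⟨_, postcomp_mem g hρ, postcomp_mono _ hσρ, by rw [dom_postcomp, hd], ih hyρ⟩
    · have ha' : rng σ ⊆ a.image ((g⁻¹ : G) : Equiv.Perm ℕ) := by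
        intro k hk
        rw [rng_postcomp] at ha
        exact Finset.mem_image.2 ⟨_, ha (Finset.mem_image_of_mem _ hk), by simp⟩
      obtain ⟨ρ, hρ, hσρ, hd, hyρ⟩ := hy.2 _ ha'
      refine ⟨_, postcomp_mem g hρ, postcomp_mono _ hσρ, ?_, ih hyρ⟩
      rw [rng_postcomp, hd]
      simp [Finset.image_image, Function.comp_def]
  | limit lam hlam ih =>
    rw [mem_alphaSet_limit hlam] at *
    exact fun β hβ hβ₀ => ih β hβ hβ₀ (hy β hβ hβ₀)

theorem smul_mem_alphaSet_of_fixing (h𝓐 : TopologicalSpace.IsTopologicalBasis 𝓐) (hα : 0 < α)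
    {g : G} (hg : g ∈ fixing G (rng σ)) (hy : y ∈ alphaSet G 𝓐 x α σ) :
    g • y ∈ alphaSet G 𝓐 x α σ := by
  simpa only [postcomp_eq_self hg] using smul_mem_alphaSet h𝓐 hα g hy

/-- The back-and-forth argument: for a fixed range `c`, the α-sets `B_α(x, σ)` with
`rng σ = c` are pairwise equal or disjoint. -/
theorem alphaSet_subset_of_mem (h𝓐 : TopologicalSpace.IsTopologicalBasis 𝓐) (hα : 0 < α)
    (hc : rng σ = rng τ) (hσ : y ∈ alphaSet G 𝓐 x α σ) (hτ : y ∈ alphaSet G 𝓐 x α τ) :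
    alphaSet G 𝓐 x α σ ⊆ alphaSet G 𝓐 x α τ := by
  induction α, hα using ordinal_pos_induction generalizing σ τ with
  | one => rw [alphaSet_one] at *; exact oneSet_eq_of_mem hc hσ hτ
  | succ α hα ih =>
    intro z hz
    rw [alphaSet_add_one G 𝓐 x hα, mem_succStep_iff] at *
    -- If `z` lies in `B_α(x, σ₂)`, then the element of `G` taking `σ₁` to `σ₂` also takes the
    -- extension `τ₁` of `τ` to one whose α-set contains `z`.
    have move : ∀ {σ₁ σ₂ τ₁ : Finset (ℕ × ℕ)}, σ₁ ∈ finPartial G → σ₂ ∈ finPartial G →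
        τ₁ ∈ finPartial G → dom σ₁ = dom σ₂ → σ ⊆ σ₁ → σ ⊆ σ₂ → τ ⊆ τ₁ → rng σ₁ = rng τ₁ →
        y ∈ alphaSet G 𝓐 x α σ₁ → y ∈ alphaSet G 𝓐 x α τ₁ → z ∈ alphaSet G 𝓐 x α σ₂ →
        ∃ ρ ∈ finPartial G, τ ⊆ ρ ∧ dom ρ = dom τ₁ ∧ rng ρ = rng σ₂ ∧
          z ∈ alphaSet G 𝓐 x α ρ := by
      intro σ₁ σ₂ τ₁ h₁ h₂ h₃ hd hσ₁ hσ₂ hτ₁ hr hy₁ hy₂ hz₂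
      obtain ⟨g, hg, rfl⟩ := exists_postcomp_eq h₁ h₂ hd hσ₁ hσ₂
      have hgτ : postcomp (g : Equiv.Perm ℕ) τ = τ := postcomp_eq_self (hc ▸ hg)
      refine ⟨postcomp (g : Equiv.Perm ℕ) τ₁, postcomp_mem g h₃, hgτ ▸ postcomp_mono _ hτ₁,
        dom_postcomp _ _, by rw [rng_postcomp, rng_postcomp, hr], ?_⟩
      have hz' : g⁻¹ • z ∈ alphaSet G 𝓐 x α σ₁ := by
        have := smul_mem_alphaSet h𝓐 hα g⁻¹ hz₂
        rwa [postcomp_postcomp, postcomp_eq_self fun k _ => by simp] at this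
      simpa using smul_mem_alphaSet h𝓐 hα g (ih hr hy₁ hy₂ hz')
    refine ⟨fun b hb => ?_, fun a ha => ?_⟩
    · obtain ⟨τ₁, hτ₁, hττ₁, hb₁, hy₁⟩ := hτ.1 b hb
      obtain ⟨σ₁, hσ₁, hσσ₁, hr₁, hy₂⟩ := hσ.2 (rng τ₁) (hc ▸ rng_mono hττ₁)
      obtain ⟨σ₂, hσ₂, hσσ₂, hd₂, hz₂⟩ := hz.1 (dom σ₁) (dom_mono hσσ₁)
      obtain ⟨ρ, hρ, hτρ, hd, -, hzρ⟩ :=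
        move hσ₁ hσ₂ hτ₁ hd₂.symm hσσ₁ hσσ₂ hττ₁ hr₁ hy₂ hy₁ hz₂
      exact ⟨ρ, hρ, hτρ, hd.trans hb₁, hzρ⟩
    · obtain ⟨σ₂, hσ₂, hσσ₂, hr₂, hz₂⟩ := hz.2 a (hc ▸ ha)
      obtain ⟨σ₁, hσ₁, hσσ₁, hd₁, hy₁⟩ := hσ.1 (dom σ₂) (dom_mono hσσ₂)
      obtain ⟨τ₁, hτ₁, hττ₁, hr₁, hy₂⟩ := hτ.2 (rng σ₁) (hc ▸ rng_mono hσσ₁)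
      obtain ⟨ρ, hρ, hτρ, -, hr, hzρ⟩ :=
        move hσ₁ hσ₂ hτ₁ hd₁ hσσ₁ hσσ₂ hττ₁ hr₁.symm hy₁ hy₂ hz₂
      exact ⟨ρ, hρ, hτρ, hr.trans hr₂, hzρ⟩
  | limit lam hlam ih =>
    intro z hz
    rw [mem_alphaSet_limit hlam] at *
    exact fun β hβ hβ₀ => ih β hβ hβ₀ hc (hσ β hβ hβ₀) (hτ β hβ hβ₀) (hz β hβ hβ₀)

end AlphaSet

/-! ### Polish topologies on subsets -/

/-- The subset `S` of `X` is Polish in the subspace topology induced by the topology `T` on `X`.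
The topology is an explicit argument, since several topologies on `X` are compared. -/
def PolishOn {X : Type*} (T : TopologicalSpace X) (S : Set X) : Prop :=
  @PolishSpace S (T.induced Subtype.val)

/-- A space that is the limit of countably many Polish spaces over a common Hausdorff space is
Polish: it is a closed subspace of their product. -/
theorem polishSpace_of_isInducing {ι Q X : Type*} [Countable ι] {P : ι → Type*}
    [TopologicalSpace Q] [∀ i, TopologicalSpace (P i)] [∀ i, PolishSpace (P i)]
    [TopologicalSpace X] [T2Space X] (f : ∀ i, Q → P i) (v : ∀ i, P i → X)
    (hv : ∀ i, Continuous (v i)) (hf : Topology.IsInducing fun q i => f i q)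
    (hinj : Function.Injective fun q i => f i q)
    (hrange : ∀ p : ∀ i, P i, (∃ q, ∀ i, f i q = p i) ↔ ∀ i j, v i (p i) = v j (p j)) :
    PolishSpace Q := by
  refine Topology.IsClosedEmbedding.polishSpace (f := fun q i => f i q) ⟨⟨hf, hinj⟩, ?_⟩
  have : Set.range (fun q i => f i q) = ⋂ i, ⋂ j, {p | v i (p i) = v j (p j)} := by
    ext p
    simp only [Set.mem_range, Set.mem_iInter, Set.mem_ofPred_eq, ← hrange, funext_iff]
  rw [this]
  exact isClosed_iInter fun i => isClosed_iInter fun j =>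
    isClosed_eq ((hv i).comp (continuous_apply i)) ((hv j).comp (continuous_apply j))

theorem polishSpace_of_isEmbedding {α β : Type*} [TopologicalSpace α] [TopologicalSpace β]
    {f : α → β} (hf : Topology.IsEmbedding f) [PolishSpace (Set.range f)] : PolishSpace α :=
  hf.toHomeomorph.isClosedEmbedding.polishSpace

section PolishOn

variable {X : Type*} {T : TopologicalSpace X} {S : Set X}

theorem PolishOn.iInter {ι : Type*} [Countable ι] [Nonempty ι] {T₀ : TopologicalSpace X}
    [T2Space X] {T : ι → TopologicalSpace X} {S : ι → Set X} (hT : ∀ i, T i ≤ T₀)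
    (h : ∀ i, PolishOn (T i) (S i)) : PolishOn (⨅ i, T i) (⋂ i, S i) := by
  let : ∀ i, TopologicalSpace (S i) := fun i => (T i).induced Subtype.val
  let : TopologicalSpace (⋂ i, S i : Set X) := (⨅ i, T i).induced Subtype.val
  have : ∀ i, PolishSpace (S i) := h
  refine polishSpace_of_isInducing (Q := (⋂ i, S i : Set X))
    (fun i q => (⟨q, Set.mem_iInter.1 q.2 i⟩ : S i)) (fun i p => (p : X))
    (fun i => continuous_iff_le_induced.2 (induced_mono (hT i))) ⟨?_⟩ ?_ ?_
  · change (⨅ i, T i).induced Subtype.val =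
      TopologicalSpace.induced _ (⨅ i, TopologicalSpace.induced _ ((T i).induced Subtype.val))
    simp only [induced_iInf, induced_compose]
    rfl
  · intro p q hpq
    obtain ⟨i⟩ := ‹Nonempty ι›
    exact Subtype.ext (congrArg (fun r => ((r i : S i) : X)) hpq)
  · intro p
    constructor
    · rintro ⟨q, hq⟩ i j
      rw [← hq i, ← hq j]
    · intro hp
      obtain ⟨i⟩ := ‹Nonempty ι›
      exact ⟨⟨p i, Set.mem_iInter.2 fun j => hp i j ▸ (p j).2⟩, fun j => Subtype.ext (hp i j)⟩

theorem PolishOn.inter_isOpen (h : PolishOn T S) {U : Set X} (hU : IsOpen U) :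
    PolishOn T (S ∩ U) := by
  have : PolishSpace S := h
  have hf : Topology.IsEmbedding (Set.inclusion (Set.inter_subset_left : S ∩ U ⊆ S)) :=
    Topology.IsEmbedding.inclusion _
  have : PolishSpace (Set.range (Set.inclusion (Set.inter_subset_left : S ∩ U ⊆ S))) := by
    apply IsOpen.polishSpace
    convert hU.preimage (continuous_subtype_val (p := (· ∈ S))) using 1
    ext y
    simp [Set.range_inclusion]
  exact polishSpace_of_isEmbedding hf

theorem PolishOn.inter_isGδ {T₀ : TopologicalSpace X} (hT₀ : @T2Space X T₀) (hT : T ≤ T₀)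
    (h : PolishOn T S) {U : Set X} (hU : @IsGδ X T U) : PolishOn T (S ∩ U) := by
  obtain ⟨𝓤, h𝓤, hc, rfl⟩ := hU
  rcases 𝓤.eq_empty_or_nonempty with rfl | hne
  · simpa using h
  have := hc.to_subtype
  have := hne.to_subtype
  have key := @PolishOn.iInter X 𝓤 _ _ T₀ hT₀ (fun _ => T) (fun U => S ∩ U) (fun _ => hT)
    fun U => h.inter_isOpen (h𝓤 U U.2)
  rwa [iInf_const, ← Set.inter_iInter, ← Set.sInter_eq_iInter] at key

/-- Making the members of a countable disjoint family of Polish subsets open turns their union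
into a topological sum of Polish spaces. -/
theorem PolishOn.sUnion {𝓓 : Set (Set X)} (hc : 𝓓.Countable)
    (hd : ∀ D ∈ 𝓓, ∀ D' ∈ 𝓓, (D ∩ D').Nonempty → D = D') (h : ∀ D ∈ 𝓓, PolishOn T D) :
    PolishOn (T ⊓ TopologicalSpace.generateFrom 𝓓) (⋃₀ 𝓓) := by
  have hD : ∀ D ∈ 𝓓, PolishOn (T ⊓ TopologicalSpace.generateFrom 𝓓) D := by
    intro D hD
    have : (T ⊓ TopologicalSpace.generateFrom 𝓓).induced (Subtype.val : D → X) =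
        T.induced Subtype.val := by
      rw [induced_inf, inf_eq_left, induced_generateFrom_eq]
      refine le_generateFrom ?_
      rintro _ ⟨D', hD', rfl⟩
      by_cases hne : (D ∩ D').Nonempty
      · obtain rfl := hd D hD D' hD' hne
        rw [Subtype.coe_preimage_self]
        exact @isOpen_univ _ (T.induced Subtype.val)
      · have : (Subtype.val ⁻¹' D' : Set D) = ∅ :=
          Set.eq_empty_of_forall_notMem fun y hy => hne ⟨y, y.2, hy⟩
        rw [this]
        exact @isOpen_empty _ (T.induced Subtype.val)
    rw [PolishOn, this]
    exact h D hD
  have hopen : ∀ D ∈ 𝓓, IsOpen[T ⊓ TopologicalSpace.generateFrom 𝓓] D := fun D hD =>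
    (inf_le_right : T ⊓ TopologicalSpace.generateFrom 𝓓 ≤ _) _
      (TopologicalSpace.isOpen_generateFrom_of_mem hD)
  generalize T ⊓ TopologicalSpace.generateFrom 𝓓 = T' at hD hopen
  let := T'
  have : ∀ D : 𝓓, PolishSpace (D : Set X) := fun D => hD D D.2
  have := hc.to_subtype
  let φ : (Σ D : 𝓓, (D : Set X)) → (⋃₀ 𝓓 : Set X) := fun p => ⟨p.2, p.1, p.1.2, p.2.2⟩
  have hφ : IsHomeomorph φ := by
    refine ⟨continuous_sigma fun D => continuous_subtype_val.subtype_mk _,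
      isOpenMap_sigma.2 fun D U hU => ?_, ?_, ?_⟩
    · convert ((hopen D D.2).isOpenMap_subtype_val U hU).preimage continuous_subtype_val using 1
      ext y
      simp only [Set.mem_image, Set.mem_preimage, φ, Subtype.ext_iff]
    · rintro ⟨⟨D, hD⟩, y, hy⟩ ⟨⟨D', hD'⟩, y', hy'⟩ hyy
      obtain rfl : y = y' := congrArg Subtype.val hyy
      obtain rfl := hd D hD D' hD' ⟨y, hy, hy'⟩
      rfl
    · rintro ⟨y, D, hD, hy⟩
      exact ⟨⟨⟨D, hD⟩, y, hy⟩, rfl⟩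
  exact hφ.homeomorph.symm.isClosedEmbedding.polishSpace

end PolishOn

/-! ### The topologies generated by the α-sets -/

theorem isGδ_succStep {G : Subgroup (Equiv.Perm ℕ)} {X : Type*} {T : TopologicalSpace X}
    {B : Finset (ℕ × ℕ) → Set X}
    (hB : ∀ ρ ∈ finPartial G, IsOpen (B ρ)) (σ : Finset (ℕ × ℕ)) : IsGδ (succStep G B σ) :=
  (IsGδ.biInter_of_isOpen (Set.to_countable _) fun _ _ =>
    isOpen_biUnion fun ρ hρ => hB ρ hρ.1).inter
  (IsGδ.biInter_of_isOpen (Set.to_countable _) fun _ _ =>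
    isOpen_biUnion fun ρ hρ => hB ρ hρ.1)

section BelowTopology

/-- The topology on the whole space `X` generated by `𝓑^x_{<α}`. -/
abbrev belowTopology (G : Subgroup (Equiv.Perm ℕ)) {X : Type*} [MulAction G X] (𝓐 : Set (Set X))
    (x : X) (α : Ordinal.{0}) : TopologicalSpace X :=
  TopologicalSpace.generateFrom (familyBelow G 𝓐 x α)

variable {G : Subgroup (Equiv.Perm ℕ)} {X : Type*} [MulAction G X] {𝓐 : Set (Set X)} {x y : X}
  {σ : Finset (ℕ × ℕ)} {α β γ : Ordinal.{0}}

theorem alphaTopology_eq_induced :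
    alphaTopology G 𝓐 x α = (belowTopology G 𝓐 x α).induced Subtype.val :=
  induced_generateFrom_eq.symm

theorem mem_familyBelow {B : Set X} :
    B ∈ familyBelow G 𝓐 x α ↔ ∃ γ < α, B ∈ family G 𝓐 x γ := by
  simp [familyBelow]

theorem family_zero : family G 𝓐 x 0 = 𝓐 := if_pos rfl

theorem family_of_pos (h : 0 < α) : family G 𝓐 x α = alphaSet G 𝓐 x α '' finPartial G :=
  if_neg h.ne'

theorem basis_subset_familyBelow (h : 0 < α) : 𝓐 ⊆ familyBelow G 𝓐 x α := fun A hA =>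
  mem_familyBelow.2 ⟨0, h, by rwa [family_zero]⟩

theorem alphaSet_mem_familyBelow (hγ : 0 < γ) (h : γ < α) (hσ : σ ∈ finPartial G) :
    alphaSet G 𝓐 x γ σ ∈ familyBelow G 𝓐 x α :=
  mem_familyBelow.2 ⟨γ, h, by rw [family_of_pos hγ]; exact ⟨σ, hσ, rfl⟩⟩

theorem mem_familyBelow_cases {B : Set X} (hB : B ∈ familyBelow G 𝓐 x α) :
    B ∈ 𝓐 ∨ ∃ γ, 0 < γ ∧ γ < α ∧ ∃ σ ∈ finPartial G, alphaSet G 𝓐 x γ σ = B := by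
  obtain ⟨γ, hγ, hB⟩ := mem_familyBelow.1 hB
  rcases eq_or_ne γ 0 with rfl | h₀
  · rw [family_zero] at hB
    exact Or.inl hB
  · have h₀ := pos_iff_ne_zero.2 h₀
    rw [family_of_pos h₀] at hB
    exact Or.inr ⟨γ, h₀, hγ, hB⟩

theorem familyBelow_one : familyBelow G 𝓐 x 1 = 𝓐 := by
  ext B
  simp [mem_familyBelow, family_zero]

theorem familyBelow_add_one :
    familyBelow G 𝓐 x (α + 1) = familyBelow G 𝓐 x α ∪ family G 𝓐 x α := by
  ext B
  simp only [mem_familyBelow, Set.mem_union, Order.lt_add_one_iff, le_iff_lt_or_eq]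
  constructor
  · rintro ⟨γ, hγ | rfl, h⟩
    exacts [Or.inl ⟨γ, hγ, h⟩, Or.inr h]
  · rintro (⟨γ, hγ, h⟩ | h)
    exacts [⟨γ, Or.inl hγ, h⟩, ⟨α, Or.inr rfl, h⟩]

theorem familyBelow_mono (h : α ≤ β) : familyBelow G 𝓐 x α ⊆ familyBelow G 𝓐 x β := fun B hB => by
  obtain ⟨γ, hγ, hB⟩ := mem_familyBelow.1 hB
  exact mem_familyBelow.2 ⟨γ, hγ.trans_le h, hB⟩

theorem familyBelow_limit {lam : Ordinal.{0}} (hlam : Order.IsSuccLimit lam) :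
    familyBelow G 𝓐 x lam = ⋃ β : {β : Ordinal.{0} // 0 < β ∧ β < lam}, familyBelow G 𝓐 x β := by
  refine subset_antisymm (fun B hB => ?_)
    (Set.iUnion_subset fun β => familyBelow_mono β.2.2.le)
  obtain ⟨γ, hγ, hB⟩ := mem_familyBelow.1 hB
  exact Set.mem_iUnion.2 ⟨⟨γ + 1, by simp, hlam.add_one_lt hγ⟩,
    mem_familyBelow.2 ⟨γ, by simp, hB⟩⟩

theorem countable_Iio_of_lt_omega_one (h : α < Ordinal.omega 1) : (Set.Iio α).Countable := by
  rw [Cardinal.lt_omega_iff_card_lt, ← Cardinal.succ_aleph0, Order.lt_succ_iff] at h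
  rw [← Cardinal.le_aleph0_iff_set_countable, Cardinal.mk_Iio_ordinal,
    Cardinal.lift_le_aleph0]
  exact h

theorem isOpen_alphaSet (hγ : 0 < γ) (h : γ < α) (hσ : σ ∈ finPartial G) :
    IsOpen[belowTopology G 𝓐 x α] (alphaSet G 𝓐 x γ σ) :=
  TopologicalSpace.isOpen_generateFrom_of_mem (alphaSet_mem_familyBelow hγ h hσ)

variable [T : TopologicalSpace X]

theorem belowTopology_one (h𝓐 : TopologicalSpace.IsTopologicalBasis 𝓐) :
    belowTopology G 𝓐 x 1 = T := by
  rw [belowTopology, familyBelow_one, h𝓐.eq_generateFrom]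

theorem belowTopology_le (h𝓐 : TopologicalSpace.IsTopologicalBasis 𝓐) (hα : 0 < α) :
    belowTopology G 𝓐 x α ≤ T := by
  rw [h𝓐.eq_generateFrom]
  exact TopologicalSpace.generateFrom_anti (basis_subset_familyBelow hα)

variable [ContinuousConstSMul G X]

theorem isGδ_oneSet [PolishSpace X] (h𝓐c : 𝓐.Countable)
    (h𝓐 : TopologicalSpace.IsTopologicalBasis 𝓐) (σ : Finset (ℕ × ℕ)) :
    IsGδ (oneSet G 𝓐 x σ) := by
  let := TopologicalSpace.upgradeIsCompletelyMetrizable X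
  exact (IsGδ.biInter_of_isOpen (h𝓐c.mono fun _ h => h.1) fun A hA =>
    isOpen_fixing_smul _ (h𝓐.isOpen hA.1)).inter
    (IsGδ.biInter (h𝓐c.mono fun _ h => h.1) fun A hA =>
      (isOpen_fixing_smul _ (h𝓐.isOpen hA.1)).isClosed_compl.isGδ)

theorem isGδ_alphaSet [PolishSpace X] (h𝓐c : 𝓐.Countable)
    (h𝓐 : TopologicalSpace.IsTopologicalBasis 𝓐) (hα : 0 < α) (hα₁ : α < Ordinal.omega 1)
    (hσ : σ ∈ finPartial G) : @IsGδ X (belowTopology G 𝓐 x α) (alphaSet G 𝓐 x α σ) := by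
  induction α, hα using ordinal_pos_induction with
  | one =>
    rw [belowTopology_one h𝓐, alphaSet_one]
    exact isGδ_oneSet h𝓐c h𝓐 σ
  | succ α hα _ =>
    rw [alphaSet_add_one G 𝓐 x hα]
    exact isGδ_succStep (fun ρ hρ => isOpen_alphaSet hα (by simp) hρ) σ
  | limit lam hlam _ =>
    have hlam' : alphaSet G 𝓐 x lam σ =
        ⋂ β ∈ {β : Ordinal.{0} | β < lam ∧ 0 < β}, alphaSet G 𝓐 x β σ := by
      ext y
      simp [mem_alphaSet_limit hlam]
    rw [hlam']
    refine @IsGδ.biInter_of_isOpen X _ (belowTopology G 𝓐 x lam) _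
      ((countable_Iio_of_lt_omega_one hα₁).mono fun _ h => h.1) _ fun β hβ => ?_
    exact isOpen_alphaSet hβ.2 hβ.1 hσ

theorem polishOn_alphaSet [PolishSpace X] (h𝓐c : 𝓐.Countable)
    (h𝓐 : TopologicalSpace.IsTopologicalBasis 𝓐) (hα : 0 < α) (hα₁ : α < Ordinal.omega 1) :
    PolishOn (belowTopology G 𝓐 x α) (alphaSet G 𝓐 x α ∅) := by
  induction α, hα using ordinal_pos_induction with
  | one =>
    have huniv : PolishOn T (Set.univ : Set X) := isClosed_univ.polishSpace
    rw [belowTopology_one h𝓐, alphaSet_one, ← Set.univ_inter (oneSet G 𝓐 x ∅)]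
    exact huniv.inter_isGδ inferInstance le_rfl (isGδ_oneSet h𝓐c h𝓐 ∅)
  | succ α hα ih =>
    have hα' : α < Ordinal.omega 1 := lt_trans (by simp) hα₁
    -- The α-sets with a given range `a` are made open simultaneously; this is done for each `a`.
    let 𝓓 : Finset ℕ → Set (Set X) := fun a =>
      alphaSet G 𝓐 x α '' {ρ ∈ finPartial G | rng ρ = a}
    have hsum : ∀ a, PolishOn (belowTopology G 𝓐 x α ⊓ TopologicalSpace.generateFrom (𝓓 a))
        (⋃₀ 𝓓 a) := by
      intro a
      refine PolishOn.sUnion ((Set.to_countable _).image _) ?_ ?_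
      · rintro _ ⟨ρ, hρ, rfl⟩ _ ⟨τ, hτ, rfl⟩ ⟨y, hyρ, hyτ⟩
        have h : rng ρ = rng τ := hρ.2.trans hτ.2.symm
        exact subset_antisymm (alphaSet_subset_of_mem h𝓐 hα h hyρ hyτ)
          (alphaSet_subset_of_mem h𝓐 hα h.symm hyτ hyρ)
      · rintro _ ⟨ρ, hρ, rfl⟩
        rw [← Set.inter_eq_right.2 (alphaSet_subset_empty h𝓐 hα hρ.1)]
        exact (ih hα').inter_isGδ inferInstance (belowTopology_le h𝓐 hα)
          (isGδ_alphaSet h𝓐c h𝓐 hα hα' hρ.1)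
    have hT : belowTopology G 𝓐 x (α + 1) =
        ⨅ a, belowTopology G 𝓐 x α ⊓ TopologicalSpace.generateFrom (𝓓 a) := by
      have hU : family G 𝓐 x α = ⋃ a, 𝓓 a := by
        rw [family_of_pos hα]
        ext B
        simp [𝓓]
      rw [← inf_iInf, ← generateFrom_iUnion, ← hU, belowTopology, belowTopology,
        familyBelow_add_one, generateFrom_union]
    have hsub : alphaSet G 𝓐 x (α + 1) ∅ ⊆ ⋂ a, ⋃₀ 𝓓 a := by
      intro y hy
      rw [alphaSet_add_one G 𝓐 x hα, mem_succStep_iff] at hy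
      refine Set.mem_iInter.2 fun a => ?_
      obtain ⟨ρ, hρ, -, ha, hyρ⟩ := hy.2 a (Finset.empty_subset a)
      exact ⟨_, ⟨ρ, ⟨hρ, ha⟩, rfl⟩, hyρ⟩
    have hpolish : PolishOn (belowTopology G 𝓐 x (α + 1)) (⋂ a, ⋃₀ 𝓓 a) := by
      rw [hT]
      exact PolishOn.iInter (fun a => inf_le_left.trans (belowTopology_le h𝓐 hα)) hsum
    rw [← Set.inter_eq_right.2 hsub]
    exact hpolish.inter_isGδ inferInstance (belowTopology_le h𝓐 (by simp))
      (isGδ_alphaSet h𝓐c h𝓐 (by simp) hα₁ empty_mem_finPartial)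
  | limit lam hlam ih =>
    have : Countable {β : Ordinal.{0} // 0 < β ∧ β < lam} :=
      ((countable_Iio_of_lt_omega_one hα₁).mono fun _ h => h.2 :
        {β : Ordinal.{0} | 0 < β ∧ β < lam}.Countable).to_subtype
    have : Nonempty {β : Ordinal.{0} // 0 < β ∧ β < lam} :=
      ⟨⟨0 + 1, by simp, hlam.add_one_lt hlam.bot_lt⟩⟩
    have hset : alphaSet G 𝓐 x lam ∅ =
        ⋂ β : {β : Ordinal.{0} // 0 < β ∧ β < lam}, alphaSet G 𝓐 x β ∅ := by
      ext y
      simp only [mem_alphaSet_limit hlam, Set.mem_iInter, Subtype.forall]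
      exact ⟨fun h β hβ => h β hβ.2 hβ.1, fun h β hβ hβ₀ => h β ⟨hβ₀, hβ⟩⟩
    rw [belowTopology, familyBelow_limit hlam, generateFrom_iUnion, hset]
    exact PolishOn.iInter (fun β => belowTopology_le h𝓐 β.2.1)
      fun β => ih β β.2.2 β.2.1 (β.2.2.trans hα₁)

end BelowTopology

/-! ### Bases of the topologies -/

section Basis

variable {G : Subgroup (Equiv.Perm ℕ)}

theorem isOpen_fixing (c : Finset ℕ) : IsOpen (fixing G c) := by
  have : fixing G c = ⋂ k ∈ c, {g : G | (g : Equiv.Perm ℕ) k = k} := by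
    ext g
    simp [fixing]
  rw [this]
  refine isOpen_biInter_finset fun k _ => ?_
  have hk : Continuous fun g : G => (g : Equiv.Perm ℕ) k :=
    (continuous_apply k).comp (continuous_induced_dom.comp continuous_subtype_val)
  exact (isOpen_discrete {k}).preimage hk

theorem exists_fixing_subset {U : Set G} (hU : U ∈ 𝓝 (1 : G)) : ∃ c, fixing G c ⊆ U := by
  have hind : Topology.IsInducing fun g : G => ((g : Equiv.Perm ℕ) : ℕ → ℕ) :=
    Topology.IsInducing.comp (g := fun f : Equiv.Perm ℕ => (f : ℕ → ℕ)) ⟨rfl⟩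
      Topology.IsInducing.subtypeVal
  rw [hind.nhds_eq_comap, Filter.mem_comap] at hU
  obtain ⟨V, hV, hVU⟩ := hU
  rw [nhds_pi, Filter.mem_pi] at hV
  obtain ⟨I, hI, t, ht, htV⟩ := hV
  refine ⟨hI.toFinset, fun g hg => hVU (htV fun k hk => ?_)⟩
  change (g : Equiv.Perm ℕ) k ∈ t k
  rw [hg k (hI.mem_toFinset.2 hk)]
  exact mem_of_mem_nhds (ht k)

variable {X : Type*} [MulAction G X] {𝓐 : Set (Set X)} {x y : X} {σ : Finset (ℕ × ℕ)}
  {α γ : Ordinal.{0}} [TopologicalSpace X]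

/-- By regularity of `X`, a neighbourhood of `y` contains every `1`-set around `y` whose partial
map has a sufficiently large range. -/
theorem exists_oneSet_subset [RegularSpace X] [ContinuousSMul G X]
    (h𝓐 : TopologicalSpace.IsTopologicalBasis 𝓐) {A : Set X} (hA : IsOpen A) (hy : y ∈ A) :
    ∃ c : Finset ℕ, ∀ ρ, c ⊆ rng ρ → y ∈ oneSet G 𝓐 x ρ → oneSet G 𝓐 x ρ ⊆ A := by
  obtain ⟨F, hF, hFc, hFA⟩ := exists_mem_nhds_isClosed_subset (hA.mem_nhds hy)
  have hcont : Continuous fun g : G => g • y := by fun_prop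
  obtain ⟨c, hc⟩ := exists_fixing_subset (U := (fun g : G => g • y) ⁻¹' F)
    (hcont.continuousAt.preimage_mem_nhds (by simpa using hF))
  refine ⟨c, fun ρ hρ hyρ z hz => hFA (by_contra fun hzF => ?_)⟩
  rw [mem_oneSet_iff_isOpen h𝓐] at hyρ hz
  -- The translates of `y` by `V_c` stay in the closed set `F`, so those of `z` do too.
  obtain ⟨g, hg, hgF⟩ := (hyρ _ hFc.isOpen_compl).2
    ((hz _ hFc.isOpen_compl).1 ⟨1, one_mem_fixing _, by simpa using hzF⟩)
  exact hgF (hc (fixing_anti hρ hg))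

theorem exists_alphaSet_subset [RegularSpace X] [ContinuousSMul G X]
    (h𝓐 : TopologicalSpace.IsTopologicalBasis 𝓐) (hα : 1 < α) {B : Set X}
    (hB : B ∈ familyBelow G 𝓐 x α) (hy : y ∈ B) :
    ∃ γ, 0 < γ ∧ γ < α ∧ ∃ c : Finset ℕ, ∀ δ, γ ≤ δ → ∀ ρ ∈ finPartial G, c ⊆ rng ρ →
      y ∈ alphaSet G 𝓐 x δ ρ → alphaSet G 𝓐 x δ ρ ⊆ B := by
  rcases mem_familyBelow_cases hB with hA | ⟨γ, hγ, hγα, σ, hσ, rfl⟩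
  · obtain ⟨c, hc⟩ := exists_oneSet_subset (G := G) (x := x) h𝓐 (h𝓐.isOpen hA) hy
    refine ⟨1, one_pos, hα, c, fun δ hδ ρ _ hcρ hyρ => ?_⟩
    have hanti := alphaSet_antitone (G := G) (x := x) h𝓐 one_pos hδ ρ
    rw [alphaSet_one] at hanti
    exact hanti.trans (hc ρ hcρ (hanti hyρ))
  · refine ⟨γ, hγ, hγα, rng σ, fun δ hδ ρ hρ hcρ hyρ => ?_⟩
    obtain ⟨π, hπ, -, hπρ, hπσ⟩ := exists_restrict_rng hρ (Finset.empty_subset ρ)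
      (Finset.empty_subset (rng σ)) hcρ
    have hsub : alphaSet G 𝓐 x δ ρ ⊆ alphaSet G 𝓐 x γ π :=
      (alphaSet_antitone h𝓐 hγ hδ ρ).trans (alphaSet_anti h𝓐 hγ hρ hπρ)
    exact hsub.trans (alphaSet_subset_of_mem h𝓐 hγ hπσ (hsub hyρ) hy)

theorem exists_familyBelow_subset_inter [RegularSpace X] [ContinuousSMul G X]
    (h𝓐 : TopologicalSpace.IsTopologicalBasis 𝓐) (hα : 0 < α) {B B' : Set X}
    (hB : B ∈ familyBelow G 𝓐 x α) (hB' : B' ∈ familyBelow G 𝓐 x α)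
    (hy : y ∈ alphaSet G 𝓐 x α ∅) (hyB : y ∈ B) (hyB' : y ∈ B') :
    ∃ C ∈ familyBelow G 𝓐 x α, y ∈ C ∧ C ⊆ B ∩ B' := by
  rcases (Order.one_le_iff_pos.2 hα).eq_or_lt with rfl | h
  · rw [familyBelow_one] at *
    exact h𝓐.exists_subset_inter B hB B' hB' y ⟨hyB, hyB'⟩
  obtain ⟨γ, hγ, hγα, c, hc⟩ := exists_alphaSet_subset h𝓐 h hB hyB
  obtain ⟨γ', -, hγα', c', hc'⟩ := exists_alphaSet_subset h𝓐 h hB' hyB'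
  have hδ : 0 < max γ γ' := hγ.trans_le (le_max_left _ _)
  have hδα : max γ γ' < α := max_lt hγα hγα'
  have hy' := alphaSet_antitone h𝓐 (by simp) (Order.add_one_le_of_lt hδα) ∅ hy
  rw [alphaSet_add_one G 𝓐 x hδ, mem_succStep_iff] at hy'
  obtain ⟨ρ, hρ, -, ha, hyρ⟩ := hy'.2 (c ∪ c') (Finset.empty_subset _)
  exact ⟨_, alphaSet_mem_familyBelow hδ hδα hρ, hyρ, Set.subset_inter
    (hc _ (le_max_left _ _) ρ hρ (ha ▸ Finset.subset_union_left) hyρ)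
    (hc' _ (le_max_right _ _) ρ hρ (ha ▸ Finset.subset_union_right) hyρ)⟩

theorem isTopologicalBasis_traces [RegularSpace X] [ContinuousSMul G X]
    (h𝓐 : TopologicalSpace.IsTopologicalBasis 𝓐) (hα : 0 < α) :
    @TopologicalSpace.IsTopologicalBasis _ (alphaTopology G 𝓐 x α)
      (traces (familyBelow G 𝓐 x α) (alphaSet G 𝓐 x α ∅)) := by
  let := alphaTopology G 𝓐 x α
  refine ⟨?_, Set.eq_univ_of_forall fun y => ?_, rfl⟩
  · rintro _ ⟨B, hB, rfl⟩ _ ⟨B', hB', rfl⟩ y ⟨hyB, hyB'⟩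
    obtain ⟨C, hC, hyC, hCB⟩ := exists_familyBelow_subset_inter h𝓐 hα hB hB' y.2 hyB hyB'
    exact ⟨_, ⟨C, hC, rfl⟩, hyC, Set.preimage_mono hCB⟩
  · obtain ⟨A, hA, hyA⟩ := Set.mem_sUnion.1 (h𝓐.sUnion_eq ▸ Set.mem_univ (y : X))
    exact ⟨_, ⟨A, basis_subset_familyBelow hα hA, rfl⟩, hyA⟩

/-! ### Continuity of the action -/

theorem smul_mem_alphaSet_empty [ContinuousConstSMul G X]
    (h𝓐 : TopologicalSpace.IsTopologicalBasis 𝓐) (hα : 0 < α) (g : G) (y : X)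
    (hy : y ∈ alphaSet G 𝓐 x α ∅) : g • y ∈ alphaSet G 𝓐 x α ∅ :=
  smul_mem_alphaSet h𝓐 hα g hy

theorem continuousSMul_alphaTopology [IsTopologicalGroup G] [ContinuousSMul G X]
    (h𝓐 : TopologicalSpace.IsTopologicalBasis 𝓐) (hα : 0 < α)
    (hY : ∀ g : G, ∀ y ∈ alphaSet G 𝓐 x α ∅, g • y ∈ alphaSet G 𝓐 x α ∅) :
    @ContinuousSMul G (alphaSet G 𝓐 x α ∅) (restrictedAction _ hY).toSMul _
      (alphaTopology G 𝓐 x α) := by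
  let := restrictedAction (G := G) (alphaSet G 𝓐 x α ∅) hY
  let tY := alphaTopology G 𝓐 x α
  have hval : Continuous (Subtype.val : alphaSet G 𝓐 x α ∅ → X) := by
    rw [continuous_iff_le_induced]
    change alphaTopology G 𝓐 x α ≤ _
    rw [alphaTopology_eq_induced]
    exact induced_mono (belowTopology_le h𝓐 hα)
  refine ⟨continuous_generateFrom_iff.2 ?_⟩
  rintro _ ⟨B, hB, rfl⟩
  rcases mem_familyBelow_cases hB with hA | ⟨γ, hγ, hγα, σ, hσ, rfl⟩
  · exact (h𝓐.isOpen hA).preimage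
      (continuous_fst.smul (hval.comp continuous_snd) :
        Continuous fun p : G × alphaSet G 𝓐 x α ∅ => p.1 • (p.2 : X))
  · rw [isOpen_iff_mem_nhds]
    rintro ⟨g, y⟩ hgy
    -- For `h` in the open coset `V_c g`, where `c` is the range of `σ`, one has
    -- `h • B_γ(x, g⁻¹σ) = (h * g⁻¹) • B_γ(x, σ) = B_γ(x, σ)`.
    have hg : {h : G | h * g⁻¹ ∈ fixing G (rng σ)} ∈ 𝓝 g := by
      refine ((isOpen_fixing (rng σ)).preimage (continuous_mul_const g⁻¹)).mem_nhds ?_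
      simpa using one_mem_fixing (rng σ)
    have hy : (Subtype.val ⁻¹' alphaSet G 𝓐 x γ (postcomp ((g⁻¹ : G) : Equiv.Perm ℕ) σ) :
        Set (alphaSet G 𝓐 x α ∅)) ∈ 𝓝 y := by
      refine IsOpen.mem_nhds (TopologicalSpace.isOpen_generateFrom_of_mem
        ⟨_, alphaSet_mem_familyBelow hγ hγα (postcomp_mem g⁻¹ hσ), rfl⟩) ?_
      have hgy' : g • (y : X) ∈ alphaSet G 𝓐 x γ σ := hgy
      simpa using smul_mem_alphaSet h𝓐 hγ g⁻¹ hgy'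
    refine Filter.mem_of_superset (prod_mem_nhds hg hy) ?_
    rintro ⟨h, z⟩ ⟨hh, hz⟩
    have h₁ := smul_mem_alphaSet h𝓐 hγ g hz
    rw [postcomp_inv_postcomp] at h₁
    have h₂ := smul_mem_alphaSet_of_fixing h𝓐 hγ hh h₁
    rwa [smul_smul, inv_mul_cancel_right] at h₂

end Basis

end ScottAnalysis


theorem proposition17 (G : Subgroup (Equiv.Perm ℕ))
    (hG : IsClosed (G : Set (Equiv.Perm ℕ)))
    {X : Type*} [TopologicalSpace X] [MulAction G X]
    (hX : ScottAnalysis.IsPolishGSpace G X)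
    (𝓐 : Set (Set X)) (h𝓐c : 𝓐.Countable) (h𝓐 : TopologicalSpace.IsTopologicalBasis 𝓐)
    (x : X) (α : Ordinal.{0}) (hα₀ : 0 < α) (hα₁ : α < Ordinal.omega 1) :
    @TopologicalSpace.IsTopologicalBasis (ScottAnalysis.alphaSet G 𝓐 x α ∅)
        (ScottAnalysis.alphaTopology G 𝓐 x α)
        (ScottAnalysis.traces (ScottAnalysis.familyBelow G 𝓐 x α)
          (ScottAnalysis.alphaSet G 𝓐 x α ∅)) ∧
      ∃ hY : ∀ g : G, ∀ y ∈ ScottAnalysis.alphaSet G 𝓐 x α ∅,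
          g • y ∈ ScottAnalysis.alphaSet G 𝓐 x α ∅,
        @ScottAnalysis.IsPolishGSpace G (ScottAnalysis.alphaSet G 𝓐 x α ∅) _ _
          (ScottAnalysis.alphaTopology G 𝓐 x α)
          (ScottAnalysis.restrictedAction (ScottAnalysis.alphaSet G 𝓐 x α ∅) hY) := by
  obtain ⟨_, _, _, _⟩ := hX
  refine ⟨ScottAnalysis.isTopologicalBasis_traces h𝓐 hα₀,
    ScottAnalysis.smul_mem_alphaSet_empty h𝓐 hα₀, ?_⟩
  refine @ScottAnalysis.IsPolishGSpace.mk _ _ _ _ (_) (_) inferInstance inferInstance ?_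
    (ScottAnalysis.continuousSMul_alphaTopology h𝓐 hα₀ _)
  rw [ScottAnalysis.alphaTopology_eq_induced]
  exact ScottAnalysis.polishOn_alphaSet h𝓐c h𝓐 hα₀ hα₁
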